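/- \textbf{Setting.} There are $n$ bonds and periods $t=1,\dots,T$. Bond $i$ has cash flows $c_{i,t}\ge 0$. For a yield curve $y\in\mathbf R^T$, spreads $s\in\mathbf R^n$ and holdings $h\in\mathbf R^n_+$ the portfolio value is $$V(h,y,s)=\sum_{i=1}^n\sum_{t=1}^T h_ic_{i,t}\exp(-t(y_t+s_i)).$$ Fix nominal values $(y^{\rm nom},s^{\rm nom})$, let $p_i=\sum_{t}c_{i,t}\exp(-t(y^{\rm nom}_t+s^{\rm nom}_i))$ be the nominal bond prices (so $p^Th=V(h,y^{\rm nom},s^{\rm nom})$), and let $\Delta(h,y,s)=\log V(h,y,s)-\log(p^Th)$ for $p^Th>0$. Let $$\mathcal U=\{(y,s)\in\mathbf R^T\times\mathbf R^n : A(y,s)\le b\},\qquad A\in\mathbf R^{m\times(T+n)},\ b\in\mathbf R^m,$$ be nonempty and compact, and let $\Delta^{\rm wc}(h)=\min_{(y,s)\in\mathcal U}\Delta(h,y,s)$. Let $F\in\mathbf R^{nT\times(T+n)}$ be the matrix with $(F(y,s))_{i,t}=y_t+s_i$, and let $\zeta(x,t)=t\log(t/x)$ be the relative entropy, with the conventions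 $\zeta(x,0)=0$ for $x\ge0$, $\zeta(0,t)=+\infty$ for $t>0$, and $\zeta=+\infty$ if $x<0$ or $t<0$. For $\mu\in\mathbf R^m$ and $\nu\in\mathbf R^{nT}$ put $$g(h,\mu,\nu)=-\log(p^Th)-\mu^Tb-\sum_{i=1}^n\sum_{t=1}^T\zeta\Big(c_{i,t}h_i,\frac{\nu_{i,t}}t\Big)\quad\text{if } A^T\mu-F^T\nu=0,\ \sum_{i=1}^n\sum_{t=1}^T\frac{\nu_{i,t}}{t}=1,\ \nu\ge0,$$ and $g(h,\mu,\nu)=-\infty$ otherwise. \textbf{Theorem.} (1) For every $h\ge0$ with $p^Th>0$ the minimum defining $\Delta^{\rm wc}(h)$ is attained, and $$\Delta^{\rm wc}(h)=\max_{\mu\ge0,\ \nu}\ g(h,\mu,\nu),$$ where the maximum is attained. (2) For every $B>0$, $g$ is jointly concave in $(h,\mu,\nu)$ (as an extended-real-valued function) on the convex set of all $(h,\mu,\nu)$ with $h\ge0$ and $p^Th=B$. (3) Let $\phi:\mathbf R^n\to\mathbf R$ be convex, $\lambda>0$, $B>0$, and let $\mathcal H\subseteq\{h\ge 0 : p^Th=B\}$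 be convex. Then the problem $$\text{minimize}\quad \phi(h)+\lambda\Big(\mu^Tb+\sum_{i=1}^n\sum_{t=1}^T\zeta\Big(c_{i,t}h_i,\frac{\nu_{i,t}}t\Big)+\log(p^Th)\Big)$$ $$\text{subject to}\quad h\in\mathcal H,\ \mu\ge0,\ A^T\mu-F^T\nu=0,\ \sum_{i,t}\frac{\nu_{i,t}}t=1,\ \nu\ge0$$ in the variables $(h,\mu,\nu)$ is convex (convex feasible set, and an extended-real-valued objective that is convex on it), and it is equivalent to the robust construction problem of minimizing $\phi(h)-\lambda\Delta^{\rm wc}(h)$ over $h\in\mathcal H$: both have the same optimal value, and $h$ solves the robust construction problem if and only if $(h,\mu,\nu)$ solves the single problem for some $\mu,\nu$. -/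

import Mathlib

open scoped Matrix

noncomputable section

namespace BondPortfolio

/-- The index `t : Fin T` stands for the time period number `t + 1 ∈ {1, …, T}`. -/
def period {T : ℕ} (t : Fin T) : ℝ := (t : ℕ) + 1

/-- Price of each bond: net present value of its cash flow, for the yield curve `y` and
spreads `s`. -/
def bondPrice {n T : ℕ} (c : Fin n → Fin T → ℝ) (y : Fin T → ℝ) (s : Fin n → ℝ) : Fin n → ℝ :=
  fun i => ∑ t, c i t * Real.exp (-(period t) * (y t + s i))

/-- Portfolio value `V` for the holdings `h`, yield curve `y` and spreads `s`. -/
def portfolioValue {n T : ℕ} (c : Fin n → Fin T → ℝ) (h : Fin n → ℝ)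
    (y : Fin T → ℝ) (s : Fin n → ℝ) : ℝ :=
  ∑ i, ∑ t, h i * c i t * Real.exp (-(period t) * (y t + s i))

/-- Change in log value, `Δ = log V - log V_nom`. -/
def logChange {n T : ℕ} (c : Fin n → Fin T → ℝ) (ynom : Fin T → ℝ) (snom : Fin n → ℝ)
    (h : Fin n → ℝ) (y : Fin T → ℝ) (s : Fin n → ℝ) : ℝ :=
  Real.log (portfolioValue c h y s) - Real.log (portfolioValue c h ynom snom)

/-- The polyhedral uncertainty set `{(y, s) | A (y, s) ≤ b}`. -/
def uncertaintySet {n T m : ℕ} (A : Matrix (Fin m) (Fin T ⊕ Fin n) ℝ) (b : Fin m → ℝ) :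
    Set ((Fin T → ℝ) × (Fin n → ℝ)) :=
  {x | A *ᵥ Sum.elim x.1 x.2 ≤ b}

/-- Worst case change in log value over an uncertainty set `U`. -/
def worstCaseLogChange {n T : ℕ} (c : Fin n → Fin T → ℝ) (ynom : Fin T → ℝ) (snom : Fin n → ℝ)
    (U : Set ((Fin T → ℝ) × (Fin n → ℝ))) (h : Fin n → ℝ) : EReal :=
  ⨅ x ∈ U, (logChange c ynom snom h x.1 x.2 : EReal)

/-- The matrix `F` with `(F (y, s))_{i,t} = y_t + s_i`. -/
def spreadMatrix (n T : ℕ) : Matrix (Fin n × Fin T) (Fin T ⊕ Fin n) ℝ :=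
  Matrix.of fun q j =>
    Sum.elim (fun t => if t = q.2 then (1 : ℝ) else 0) (fun i => if i = q.1 then (1 : ℝ) else 0) j

open Classical in
/-- Relative entropy `ζ(x, t) = t log (t / x)` as an extended-real-valued function, with the usual
conventions `ζ(x, 0) = 0` for `x ≥ 0`, `ζ(0, t) = +∞` for `t > 0`, and `+∞` when `x < 0` or
`t < 0`. -/
def relEntropy (x t : ℝ) : EReal :=
  if 0 ≤ x ∧ t = 0 then 0
  else if 0 < x ∧ 0 < t then ((t * Real.log (t / x) : ℝ) : EReal)
  else ⊤

/-- The linear constraints on the dual variables other than `μ ≥ 0`. -/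
def DualConstraints {n T m : ℕ} (A : Matrix (Fin m) (Fin T ⊕ Fin n) ℝ)
    (μ : Fin m → ℝ) (ν : Fin n × Fin T → ℝ) : Prop :=
  Aᵀ *ᵥ μ - (spreadMatrix n T)ᵀ *ᵥ ν = 0 ∧ ∑ i, ∑ t, ν (i, t) / period t = 1 ∧ 0 ≤ ν

open Classical in
/-- The dual function `g(h, μ, ν)`, for the bond prices `p`. -/
def dualFun {n T m : ℕ} (c : Fin n → Fin T → ℝ) (p : Fin n → ℝ)
    (A : Matrix (Fin m) (Fin T ⊕ Fin n) ℝ) (b : Fin m → ℝ)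
    (h : Fin n → ℝ) (μ : Fin m → ℝ) (ν : Fin n × Fin T → ℝ) : EReal :=
  if DualConstraints A μ ν then
    ((-Real.log (p ⬝ᵥ h) - μ ⬝ᵥ b : ℝ) : EReal)
      - ∑ i, ∑ t, relEntropy (c i t * h i) (ν (i, t) / period t)
  else ⊥

/-- Convexity of an extended-real-valued function on a set: the set and the part of the epigraph
over it are convex. -/
def EConvexOn {E : Type*} [AddCommGroup E] [Module ℝ E] (s : Set E) (f : E → EReal) : Prop :=
  Convex ℝ s ∧ Convex ℝ {q : E × ℝ | q.1 ∈ s ∧ f q.1 ≤ (q.2 : EReal)}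

/-- Concavity of an extended-real-valued function on a set: the set and the part of the hypograph
over it are convex. -/
def EConcaveOn {E : Type*} [AddCommGroup E] [Module ℝ E] (s : Set E) (f : E → EReal) : Prop :=
  Convex ℝ s ∧ Convex ℝ {q : E × ℝ | q.1 ∈ s ∧ (q.2 : EReal) ≤ f q.1}

/-- Objective `φ(h) - λ Δ^wc(h)` of the robust bond portfolio construction problem. -/
def robustObjective {n T : ℕ} (c : Fin n → Fin T → ℝ) (ynom : Fin T → ℝ) (snom : Fin n → ℝ)
    (U : Set ((Fin T → ℝ) × (Fin n → ℝ))) (φ : (Fin n → ℝ) → ℝ) (lam : ℝ)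
    (h : Fin n → ℝ) : EReal :=
  (φ h : EReal) - (lam : EReal) * worstCaseLogChange c ynom snom U h

/-- Feasible set, in the variables `(h, μ, ν)`, of the single minimization problem. -/
def singleFeasible {n T m : ℕ} (A : Matrix (Fin m) (Fin T ⊕ Fin n) ℝ) (H : Set (Fin n → ℝ)) :
    Set ((Fin n → ℝ) × (Fin m → ℝ) × (Fin n × Fin T → ℝ)) :=
  {q | q.1 ∈ H ∧ 0 ≤ q.2.1 ∧ DualConstraints A q.2.1 q.2.2}

/-- Objective, in the variables `(h, μ, ν)`, of the single minimization problem. -/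
def singleObjective {n T m : ℕ} (c : Fin n → Fin T → ℝ) (p : Fin n → ℝ) (b : Fin m → ℝ)
    (φ : (Fin n → ℝ) → ℝ) (lam : ℝ)
    (q : (Fin n → ℝ) × (Fin m → ℝ) × (Fin n × Fin T → ℝ)) : EReal :=
  (φ q.1 : EReal) + (lam : EReal) *
    (((q.2.1 ⬝ᵥ b : ℝ) : EReal)
      + ∑ i, ∑ t, relEntropy (c i t * q.1 i) (q.2.2 (i, t) / period t)
      + ((Real.log (p ⬝ᵥ q.1) : ℝ) : EReal))

end BondPortfolio

end

namespace BondPortfolio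

/-! The entropy `ζ` is a supremum of affine functions: `ζ(x, t) ≥ t z + t - x e^z` for every `z`,
with equality at `z = log (t / x)` when `x, t > 0`. This single inequality drives both halves of the
proof.

Duality: put `z = -t (y_t + s_i) - log V` in each term and sum. The normalization of `ν` and the
definition of `V` cancel the constants, and the linear constraint turns `∑ ν (y + s)` into `μᵀ A (y,
s) ≤ μᵀ b`; this is weak duality (`neg_sub_entropySum_le`). For the converse, compactness gives a
minimizer of `V`. Since the constraints are linear, Farkas' lemma yields KKT multipliers there.
Dividing them by `V`, and letting `ν_{i,t} / t` be the share of the value carried by each cash flow,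
makes every inequality an equality (`exists_dual_eq`).

Convexity: as a supremum of affine functions, `ζ` is jointly convex, so `g` is concave once the
budget freezes `log (pᵀ h)`. The single objective equals `φ - λ g` on its feasible set, so
minimizing out `(μ, ν)` recovers the robust problem. -/

/-! ### Farkas' lemma and the KKT conditions -/

/-- **Farkas' lemma** for finitely many linear functionals. -/
theorem exists_nonneg_sum_smul_of_forall_nonneg {ι E : Type*} [AddCommGroup E] [Module ℝ E]
    (s : Finset ι) (a : ι → Module.Dual ℝ E) (f : Module.Dual ℝ E)
    (hf : ∀ x, (∀ i ∈ s, 0 ≤ a i x) → 0 ≤ f x) :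
    ∃ w : ι → ℝ, (∀ i, 0 ≤ w i) ∧ f = ∑ i ∈ s, w i • a i := by
  classical
  induction s using Finset.induction_on generalizing a f with
  | empty =>
    refine ⟨0, fun _ => le_rfl, ?_⟩
    ext x
    have h₁ := hf x (by simp)
    have h₂ := hf (-x) (by simp)
    rw [map_neg] at h₂
    simp only [Finset.sum_empty, LinearMap.zero_apply]
    linarith
  | insert k s hk ih =>
    by_cases hs : ∀ x, (∀ i ∈ s, 0 ≤ a i x) → 0 ≤ f x
    · obtain ⟨w, hw, hfw⟩ := ih a f hs
      refine ⟨fun i => if i = k then 0 else w i, fun i => by dsimp only; split_ifs <;> simp [hw], ?_⟩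
      rw [Finset.sum_insert hk, hfw]
      simp only [if_true, zero_smul, zero_add]
      refine Finset.sum_congr rfl fun i hi => ?_
      rw [if_neg (ne_of_mem_of_not_mem hi hk)]
    · push Not at hs
      obtain ⟨v, hv, hfv⟩ := hs
      have hkv : a k v < 0 := by
        by_contra! h
        exact hfv.not_ge (hf v (by simpa [h] using hv))
      -- The new functionals are the old ones composed with the projection onto the kernel of `a k`
      -- along `v`, so constraint `k` holds trivially after projecting.
      obtain ⟨w, hw, hfw⟩ := ih (fun i => a i - (a i v / a k v) • a k)
        (f - (f v / a k v) • a k) (fun x hx => by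
          have := hf (x - (a k x / a k v) • v) (by
            intro i hi
            rcases Finset.mem_insert.1 hi with rfl | hi
            · simp [hkv.ne]
            · have := hx i hi
              simp only [LinearMap.sub_apply, LinearMap.smul_apply, smul_eq_mul, map_sub,
                map_smul] at this ⊢
              convert this using 2
              ring)
          simp only [LinearMap.sub_apply, LinearMap.smul_apply, smul_eq_mul, map_sub,
            map_smul] at this ⊢
          convert this using 2
          ring)
      -- Evaluating the desired identity at `v` forces the weight of `k`; it is nonnegative because
      -- `f v` and `a k v` are negative while the sum is nonnegative.
      refine ⟨fun i => if i = k then (f v - ∑ j ∈ s, w j * a j v) / a k v else w i, ?_, ?_⟩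
      · intro i
        dsimp only
        split_ifs
        · refine div_nonneg_of_nonpos ?_ hkv.le
          have := Finset.sum_nonneg fun j hj => mul_nonneg (hw j) (hv j hj)
          linarith
        · exact hw i
      · rw [Finset.sum_insert hk]
        dsimp only
        rw [if_pos rfl]
        have : ∑ i ∈ s, (if i = k then (f v - ∑ j ∈ s, w j * a j v) / a k v else w i) • a i =
            ∑ i ∈ s, w i • a i := Finset.sum_congr rfl fun i hi => by
          rw [if_neg (ne_of_mem_of_not_mem hi hk)]
        rw [this, eq_comm, ← sub_eq_zero]
        rw [← sub_eq_zero] at hfw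
        rw [← neg_eq_zero, ← hfw]
        ext x
        simp only [LinearMap.neg_apply, LinearMap.sub_apply, LinearMap.add_apply,
          LinearMap.smul_apply, LinearMap.sum_apply, smul_eq_mul, mul_sub,
          Finset.sum_sub_distrib, sub_div, Finset.sum_div, sub_mul, Finset.sum_mul]
        have : ∑ i ∈ s, w i * a i v / a k v * a k x = ∑ i ∈ s, w i * (a i v / a k v * a k x) :=
          Finset.sum_congr rfl fun i _ => by ring
        rw [this]
        ring

/-- Karush-Kuhn-Tucker conditions for minimizing a differentiable function over a polyhedron: the
derivative at a minimizer is given along each direction by multipliers of the constraints. -/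
theorem exists_multipliers_of_isMinOn {ι κ : Type*} [Fintype ι] [Fintype κ]
    (A : Matrix ι κ ℝ) (b : ι → ℝ) (f : (κ → ℝ) → ℝ) (x g : κ → ℝ)
    (hx : A *ᵥ x ≤ b) (hmin : ∀ z, A *ᵥ z ≤ b → f x ≤ f z)
    (hg : ∀ d : κ → ℝ, HasDerivAt (fun ε : ℝ => f (x + ε • d)) (g ⬝ᵥ d) 0) :
    ∃ μ : ι → ℝ, 0 ≤ μ ∧ Aᵀ *ᵥ μ + g = 0 ∧ μ ⬝ᵥ (A *ᵥ x) = μ ⬝ᵥ b := by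
  classical
  let s : Finset ι := Finset.univ.filter fun k => (A *ᵥ x) k = b k
  let a : ι → Module.Dual ℝ (κ → ℝ) := fun k => -(LinearMap.proj k ∘ₗ A.mulVecLin)
  have key : ∀ d : κ → ℝ, (∀ k ∈ s, 0 ≤ a k d) → 0 ≤ g ⬝ᵥ d := by
    intro d hd
    -- A short step along `d` stays feasible: active constraints do not increase along `d`, inactive
    -- ones have slack. Hence the one-sided slope of `f` is nonnegative.
    have hev : ∀ᶠ ε : ℝ in nhdsWithin 0 (Set.Ioi 0), A *ᵥ (x + ε • d) ≤ b := by
      simp only [Pi.le_def]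
      rw [Filter.eventually_all]
      intro k
      by_cases hk : (A *ᵥ x) k = b k
      · filter_upwards [self_mem_nhdsWithin] with ε hε
        have h1 : (A *ᵥ d) k ≤ 0 := by
          simpa [a] using hd k (by simp [s, hk])
        rw [Matrix.mulVec_add, Matrix.mulVec_smul, Pi.add_apply, Pi.smul_apply, smul_eq_mul, hk]
        have := mul_nonpos_of_nonneg_of_nonpos (le_of_lt hε) h1
        linarith
      · have hlt : (A *ᵥ x) k < b k := lt_of_le_of_ne (hx k) hk
        have hc : Continuous fun ε : ℝ => (A *ᵥ (x + ε • d)) k := by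
          simp only [Matrix.mulVec_add, Matrix.mulVec_smul, Pi.add_apply, Pi.smul_apply]
          fun_prop
        have : ∀ᶠ ε : ℝ in nhds 0, (A *ᵥ (x + ε • d)) k < b k :=
          hc.continuousAt.eventually_lt continuousAt_const (by simpa using hlt)
        exact (this.filter_mono nhdsWithin_le_nhds).mono fun _ h => h.le
    refine ge_of_tendsto (hg d).tendsto_slope_zero_right ?_
    filter_upwards [hev, self_mem_nhdsWithin] with ε hε hpos
    have := hmin _ hε
    simp only [zero_add, zero_smul, add_zero, smul_eq_mul]
    exact mul_nonneg (inv_nonneg.2 (le_of_lt hpos)) (by linarith)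
  obtain ⟨w, hw, hfw⟩ := exists_nonneg_sum_smul_of_forall_nonneg s a
    (dotProductBilin ℝ ℝ g) key
  have hdot : ∀ d : κ → ℝ, g ⬝ᵥ d = -∑ k ∈ s, w k * (A *ᵥ d) k := by
    intro d
    have := congrArg (fun l : Module.Dual ℝ (κ → ℝ) => l d) hfw
    simpa [a] using this
  -- Multipliers vanish off the active set, which is complementary slackness.
  refine ⟨fun k => if k ∈ s then w k else 0, fun k => ?_, ?_, ?_⟩
  · dsimp only
    split_ifs
    exacts [hw k, le_rfl]
  · rw [← dotProduct_eq_zero_iff]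
    intro d
    rw [add_dotProduct, hdot, ← Matrix.vecMul_transpose, Matrix.transpose_transpose,
      ← Matrix.dotProduct_mulVec]
    simp [dotProduct, ite_mul, Finset.sum_ite_mem]
  · simp only [dotProduct]
    refine Finset.sum_congr rfl fun k _ => ?_
    by_cases hk : k ∈ s
    · rw [(Finset.mem_filter.1 hk).2]
    · simp [hk]

/-! ### Relative entropy -/

/-- The effective domain of the relative entropy. -/
def EntropyDomain (x t : ℝ) : Prop := 0 ≤ x ∧ 0 ≤ t ∧ (0 < t → 0 < x)

/-- At `t = 0` the real formula gives `0` even for `x = 0`, in agreement with the convention. -/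
theorem relEntropy_of_domain {x t : ℝ} (h : EntropyDomain x t) :
    relEntropy x t = ((t * Real.log (t / x) : ℝ) : EReal) := by
  obtain ⟨hx, ht, hxt⟩ := h
  rcases ht.eq_or_lt with rfl | ht
  · simp [relEntropy, hx]
  · rw [relEntropy, if_neg (fun h => ht.ne' h.2), if_pos ⟨hxt ht, ht⟩]

theorem relEntropy_of_not_domain {x t : ℝ} (h : ¬ EntropyDomain x t) : relEntropy x t = ⊤ := by
  rw [relEntropy, if_neg, if_neg]
  · exact fun h' => h ⟨h'.1.le, h'.2.le, fun _ => h'.1⟩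
  · exact fun h' => h ⟨h'.1, h'.2.ge, fun ht => absurd h'.2 ht.ne'⟩

theorem relEntropy_ne_bot (x t : ℝ) : relEntropy x t ≠ ⊥ := by
  by_cases h : EntropyDomain x t
  · rw [relEntropy_of_domain h]; exact EReal.coe_ne_bot _
  · rw [relEntropy_of_not_domain h]; exact top_ne_bot

/-- Fenchel-Young inequality for the relative entropy. -/
theorem EntropyDomain.le_mul_log {x t : ℝ} (h : EntropyDomain x t) (z : ℝ) :
    t * z + t - x * Real.exp z ≤ t * Real.log (t / x) := by
  obtain ⟨hx, ht, hxt⟩ := h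
  rcases ht.eq_or_lt with rfl | ht
  · have := mul_nonneg hx (Real.exp_pos z).le
    simp only [zero_mul]; linarith
  · have hx := hxt ht
    -- Multiplying `1 + u ≤ exp u` by `t`, at `u = z - log (t / x)`, gives the claim.
    have h1 := Real.add_one_le_exp (z - Real.log (t / x))
    rw [Real.exp_sub, Real.exp_log (div_pos ht hx)] at h1
    have h2 := mul_le_mul_of_nonneg_left h1 ht.le
    have h3 : t * (Real.exp z / (t / x)) = x * Real.exp z := by field_simp
    rw [h3] at h2
    nlinarith

theorem EntropyDomain.add_mul {x t x' t' α β : ℝ} (h : EntropyDomain x t)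
    (h' : EntropyDomain x' t') (hα : 0 ≤ α) (hβ : 0 ≤ β) :
    EntropyDomain (α * x + β * x') (α * t + β * t') := by
  refine ⟨add_nonneg (mul_nonneg hα h.1) (mul_nonneg hβ h'.1),
    add_nonneg (mul_nonneg hα h.2.1) (mul_nonneg hβ h'.2.1), fun hpos => ?_⟩
  have key : ∀ {x t α : ℝ}, EntropyDomain x t → 0 ≤ α → 0 < α * t → 0 < α * x := by
    intro x t α h hα hp
    have hα' : 0 < α := hα.lt_of_ne (by rintro rfl; simp at hp)
    exact mul_pos hα' (h.2.2 (pos_of_mul_pos_right hp hα))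
  by_cases hp : 0 < α * t
  · exact add_pos_of_pos_of_nonneg (key h hα hp) (mul_nonneg hβ h'.1)
  · exact add_pos_of_nonneg_of_pos (mul_nonneg hα h.1) (key h' hβ (by linarith))

/-- The relative entropy is jointly convex on its domain. -/
theorem EntropyDomain.mul_log_le {x t x' t' α β : ℝ} (h : EntropyDomain x t)
    (h' : EntropyDomain x' t') (hα : 0 ≤ α) (hβ : 0 ≤ β) :
    (α * t + β * t') * Real.log ((α * t + β * t') / (α * x + β * x')) ≤
      α * (t * Real.log (t / x)) + β * (t' * Real.log (t' / x')) := by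
  have hd := h.add_mul h' hα hβ
  set X := α * x + β * x'
  set S := α * t + β * t' with hS
  rcases hd.2.1.eq_or_lt with h0 | hpos
  · have h1 : α * t = 0 := by nlinarith [mul_nonneg hα h.2.1, mul_nonneg hβ h'.2.1]
    have h2 : β * t' = 0 := by nlinarith [mul_nonneg hα h.2.1, mul_nonneg hβ h'.2.1]
    rw [← mul_assoc, ← mul_assoc, h1, h2, ← h0]
    simp
  -- This slope makes Fenchel-Young tight at the combined point `(X, S)`: the same supporting affine
  -- function bounds both endpoints from below.
  · have h1 := mul_le_mul_of_nonneg_left (h.le_mul_log (Real.log (S / X))) hα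
    have h2 := mul_le_mul_of_nonneg_left (h'.le_mul_log (Real.log (S / X))) hβ
    have hX := hd.2.2 hpos
    rw [Real.exp_log (div_pos hpos hX)] at h1 h2
    have h3 : α * (x * (S / X)) + β * (x' * (S / X)) = S := by
      have : α * (x * (S / X)) + β * (x' * (S / X)) = X * (S / X) := by ring
      rw [this]; field_simp
    have h4 : S * Real.log (S / X) =
        α * (t * Real.log (S / X)) + β * (t' * Real.log (S / X)) := by
      rw [hS]; ring
    linarith

/-! ### Finite sums of extended reals -/

theorem ereal_sum_coe {ι : Type*} (s : Finset ι) (f : ι → ℝ) :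
    ∑ i ∈ s, (f i : EReal) = ((∑ i ∈ s, f i : ℝ) : EReal) := by
  classical
  induction s using Finset.induction_on with
  | empty => simp
  | insert a s ha ih => rw [Finset.sum_insert ha, Finset.sum_insert ha, ih, EReal.coe_add]

theorem ereal_sum_ne_bot {ι : Type*} (s : Finset ι) (f : ι → EReal) (hf : ∀ i, f i ≠ ⊥) :
    ∑ i ∈ s, f i ≠ ⊥ := by
  classical
  induction s using Finset.induction_on with
  | empty => simp
  | insert a s ha ih =>
    rw [Finset.sum_insert ha]
    exact EReal.add_ne_bot_iff.2 ⟨hf a, ih⟩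

/-- Excluding `⊥` is essential, since `⊤ + ⊥ = ⊥` in `EReal`. -/
theorem ereal_sum_eq_top {ι : Type*} (s : Finset ι) (f : ι → EReal) (hf : ∀ i, f i ≠ ⊥)
    {i : ι} (hi : i ∈ s) (hfi : f i = ⊤) : ∑ i ∈ s, f i = ⊤ := by
  classical
  rw [← Finset.add_sum_erase s f hi, hfi]
  exact EReal.top_add_of_ne_bot (ereal_sum_ne_bot _ _ hf)

/-! ### Convexity -/

variable {n T m : ℕ}

theorem period_pos (t : Fin T) : 0 < period t := by unfold period; positivity

/-- The arguments of all relative entropies in the dual function lie in the effective domain. -/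
def EntropiesFinite (c : Fin n → Fin T → ℝ) (h : Fin n → ℝ) (ν : Fin n × Fin T → ℝ) : Prop :=
  ∀ i t, EntropyDomain (c i t * h i) (ν (i, t) / period t)

/-- The real number that is the sum of the relative entropies when these are finite. -/
noncomputable def entropySum (c : Fin n → Fin T → ℝ) (h : Fin n → ℝ) (ν : Fin n × Fin T → ℝ) : ℝ :=
  ∑ i, ∑ t, ν (i, t) / period t * Real.log (ν (i, t) / period t / (c i t * h i))

theorem sum_relEntropy_of_finite {c : Fin n → Fin T → ℝ} {h : Fin n → ℝ}
    {ν : Fin n × Fin T → ℝ} (hd : EntropiesFinite c h ν) :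
    ∑ i, ∑ t, relEntropy (c i t * h i) (ν (i, t) / period t) =
      (entropySum c h ν : EReal) := by
  simp only [relEntropy_of_domain (hd _ _), ereal_sum_coe, entropySum]

theorem sum_relEntropy_of_not_finite {c : Fin n → Fin T → ℝ} {h : Fin n → ℝ}
    {ν : Fin n × Fin T → ℝ} (hd : ¬ EntropiesFinite c h ν) :
    ∑ i, ∑ t, relEntropy (c i t * h i) (ν (i, t) / period t) = ⊤ := by
  simp only [EntropiesFinite, not_forall] at hd
  obtain ⟨i, t, hit⟩ := hd
  refine ereal_sum_eq_top _ _ (fun i => ereal_sum_ne_bot _ _ fun t => relEntropy_ne_bot _ _)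
    (Finset.mem_univ i) ?_
  exact ereal_sum_eq_top _ _ (fun t => relEntropy_ne_bot _ _) (Finset.mem_univ t)
    (relEntropy_of_not_domain hit)

theorem dualFun_of_finite {c : Fin n → Fin T → ℝ} {p : Fin n → ℝ}
    {A : Matrix (Fin m) (Fin T ⊕ Fin n) ℝ} {b : Fin m → ℝ} {h : Fin n → ℝ} {μ : Fin m → ℝ}
    {ν : Fin n × Fin T → ℝ} (hc : DualConstraints A μ ν) (hd : EntropiesFinite c h ν) :
    dualFun c p A b h μ ν =
      ((-Real.log (p ⬝ᵥ h) - μ ⬝ᵥ b - entropySum c h ν : ℝ) : EReal) := by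
  rw [dualFun, if_pos hc, sum_relEntropy_of_finite hd, ← EReal.coe_sub]

theorem dualFun_of_not_finite {c : Fin n → Fin T → ℝ} {p : Fin n → ℝ}
    {A : Matrix (Fin m) (Fin T ⊕ Fin n) ℝ} {b : Fin m → ℝ} {h : Fin n → ℝ} {μ : Fin m → ℝ}
    {ν : Fin n × Fin T → ℝ} (hcd : ¬ (DualConstraints A μ ν ∧ EntropiesFinite c h ν)) :
    dualFun c p A b h μ ν = ⊥ := by
  rw [dualFun]
  split_ifs with hc
  · rw [sum_relEntropy_of_not_finite (fun hd => hcd ⟨hc, hd⟩), EReal.sub_top]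
  · rfl

theorem coe_le_dualFun_iff {c : Fin n → Fin T → ℝ} {p : Fin n → ℝ}
    {A : Matrix (Fin m) (Fin T ⊕ Fin n) ℝ} {b : Fin m → ℝ} {h : Fin n → ℝ} {μ : Fin m → ℝ}
    {ν : Fin n × Fin T → ℝ} {r : ℝ} :
    (r : EReal) ≤ dualFun c p A b h μ ν ↔ DualConstraints A μ ν ∧ EntropiesFinite c h ν ∧
      r ≤ -Real.log (p ⬝ᵥ h) - μ ⬝ᵥ b - entropySum c h ν := by
  by_cases hcd : DualConstraints A μ ν ∧ EntropiesFinite c h ν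
  · rw [dualFun_of_finite hcd.1 hcd.2, EReal.coe_le_coe_iff]
    simp [hcd.1, hcd.2]
  · rw [dualFun_of_not_finite hcd, le_bot_iff]
    exact iff_of_false (EReal.coe_ne_bot _) fun h => hcd ⟨h.1, h.2.1⟩

/-- Reduces both convexity and equivalence of the single problem to facts about `dualFun`.
Positivity of `lam` makes infinite entropy give `⊤` on both sides. -/
theorem singleObjective_eq {c : Fin n → Fin T → ℝ} {p : Fin n → ℝ}
    {A : Matrix (Fin m) (Fin T ⊕ Fin n) ℝ} {b : Fin m → ℝ} {φ : (Fin n → ℝ) → ℝ} {lam : ℝ}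
    (hlam : 0 < lam) {h : Fin n → ℝ} {μ : Fin m → ℝ} {ν : Fin n × Fin T → ℝ}
    (hc : DualConstraints A μ ν) :
    singleObjective c p b φ lam (h, μ, ν) =
      (φ h : EReal) - (lam : EReal) * dualFun c p A b h μ ν := by
  simp only [singleObjective]
  by_cases hd : EntropiesFinite c h ν
  · rw [dualFun_of_finite hc hd, sum_relEntropy_of_finite hd]
    norm_cast
    ring
  · rw [dualFun_of_not_finite fun h => hd h.2, sum_relEntropy_of_not_finite hd,
      EReal.coe_add_top, EReal.top_add_coe, EReal.coe_mul_top_of_pos hlam,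
      EReal.coe_mul_bot_of_pos hlam, EReal.coe_add_top, EReal.coe_sub_bot]

theorem convex_dualConstraints (A : Matrix (Fin m) (Fin T ⊕ Fin n) ℝ) :
    Convex ℝ {q : (Fin m → ℝ) × (Fin n × Fin T → ℝ) | DualConstraints A q.1 q.2} := by
  rintro ⟨μ, ν⟩ ⟨h₁, h₂, h₃⟩ ⟨μ', ν'⟩ ⟨h₁', h₂', h₃'⟩ α β hα hβ hαβ
  dsimp only at h₁ h₂ h₃ h₁' h₂' h₃'
  refine ⟨?_, ?_, add_nonneg (smul_nonneg hα h₃) (smul_nonneg hβ h₃')⟩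
  · have : α • (Aᵀ *ᵥ μ - (spreadMatrix n T)ᵀ *ᵥ ν) +
        β • (Aᵀ *ᵥ μ' - (spreadMatrix n T)ᵀ *ᵥ ν') = 0 := by rw [h₁, h₁']; simp
    rw [← this]
    simp only [Prod.smul_mk, Prod.mk_add_mk, Matrix.mulVec_add, Matrix.mulVec_smul, smul_sub]
    abel
  · have : α * (∑ i, ∑ t, ν (i, t) / period t) + β * (∑ i, ∑ t, ν' (i, t) / period t) = 1 := by
      rw [h₂, h₂']; linarith
    rw [← this]
    simp only [Prod.smul_mk, Prod.mk_add_mk, Finset.mul_sum, ← Finset.sum_add_distrib,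
      Pi.add_apply, Pi.smul_apply, smul_eq_mul, add_div, mul_div_assoc]

theorem EntropiesFinite.combination {c : Fin n → Fin T → ℝ} {h h' : Fin n → ℝ}
    {ν ν' : Fin n × Fin T → ℝ} (hd : EntropiesFinite c h ν) (hd' : EntropiesFinite c h' ν')
    {α β : ℝ} (hα : 0 ≤ α) (hβ : 0 ≤ β) :
    EntropiesFinite c (α • h + β • h') (α • ν + β • ν') ∧
      entropySum c (α • h + β • h') (α • ν + β • ν') ≤
        α * entropySum c h ν + β * entropySum c h' ν' := by
  have e₁ : ∀ i t, c i t * (α • h + β • h') i = α * (c i t * h i) + β * (c i t * h' i) := by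
    intro i t; simp only [Pi.add_apply, Pi.smul_apply, smul_eq_mul]; ring
  have e₂ : ∀ i t, (α • ν + β • ν') (i, t) / period t =
      α * (ν (i, t) / period t) + β * (ν' (i, t) / period t) := by
    intro i t; simp only [Pi.add_apply, Pi.smul_apply, smul_eq_mul]; ring
  constructor
  · intro i t
    rw [e₁, e₂]
    exact (hd i t).add_mul (hd' i t) hα hβ
  · simp only [entropySum, Finset.mul_sum, ← Finset.sum_add_distrib]
    refine Finset.sum_le_sum fun i _ => Finset.sum_le_sum fun t _ => ?_
    rw [e₁, e₂]
    exact (hd i t).mul_log_le (hd' i t) hα hβ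

/-- Joint concavity of the dual function over the long-only portfolios with a given budget. -/
theorem eConcaveOn_dualFun (c : Fin n → Fin T → ℝ) (p : Fin n → ℝ)
    (A : Matrix (Fin m) (Fin T ⊕ Fin n) ℝ) (b : Fin m → ℝ) (B : ℝ) :
    EConcaveOn
      {q : (Fin n → ℝ) × (Fin m → ℝ) × (Fin n × Fin T → ℝ) | 0 ≤ q.1 ∧ p ⬝ᵥ q.1 = B}
      (fun q => dualFun c p A b q.1 q.2.1 q.2.2) := by
  have hconv : Convex ℝ
      {q : (Fin n → ℝ) × (Fin m → ℝ) × (Fin n × Fin T → ℝ) | 0 ≤ q.1 ∧ p ⬝ᵥ q.1 = B} := by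
    rintro ⟨h, μ, ν⟩ ⟨h₁, h₂⟩ ⟨h', μ', ν'⟩ ⟨h₁', h₂'⟩ α β hα hβ hαβ
    dsimp only at h₁ h₂ h₁' h₂'
    refine ⟨add_nonneg (smul_nonneg hα h₁) (smul_nonneg hβ h₁'), ?_⟩
    simp only [Prod.smul_mk, Prod.mk_add_mk, dotProduct_add, dotProduct_smul, h₂, h₂', smul_eq_mul]
    rw [← add_mul, hαβ, one_mul]
  refine ⟨hconv, ?_⟩
  rintro ⟨⟨h, μ, ν⟩, r⟩ ⟨hs, hr⟩ ⟨⟨h', μ', ν'⟩, r'⟩ ⟨hs', hr'⟩ α β hα hβ hαβ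
  have hs'' := hconv hs hs' hα hβ hαβ
  refine ⟨hs'', ?_⟩
  dsimp only at hr hr'
  rw [coe_le_dualFun_iff] at hr hr'
  obtain ⟨hcon, hd, hr⟩ := hr
  obtain ⟨hcon', hd', hr'⟩ := hr'
  obtain ⟨hd'', hle⟩ := hd.combination hd' hα hβ
  have hB := hs.2
  have hB' := hs'.2
  have hB'' := hs''.2
  simp only [Prod.smul_mk, Prod.mk_add_mk] at hB hB' hB'' ⊢
  refine coe_le_dualFun_iff.2
    ⟨convex_dualConstraints A (x := (μ, ν)) hcon (y := (μ', ν')) hcon' hα hβ hαβ, hd'', ?_⟩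
  -- The term `-log (pᵀ h)` is convex in `h`, the wrong sign for concavity; the fixed budget makes
  -- it constant.
  rw [hB] at hr
  rw [hB'] at hr'
  rw [hB'', add_dotProduct, smul_dotProduct, smul_dotProduct]
  simp only [smul_eq_mul]
  have h1 := mul_le_mul_of_nonneg_left hr hα
  have h2 := mul_le_mul_of_nonneg_left hr' hβ
  have h3 : Real.log B = α * Real.log B + β * Real.log B := by rw [← add_mul, hαβ, one_mul]
  linarith

/-- Translates epigraph points of `φ - λ g` into hypograph points of `g`. -/
theorem coe_sub_mul_le_iff {f lam r : ℝ} (hlam : 0 < lam) (g : EReal) :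
    (f : EReal) - (lam : EReal) * g ≤ (r : EReal) ↔ (((f - r) / lam : ℝ) : EReal) ≤ g := by
  induction g with
  | bot =>
    rw [EReal.coe_mul_bot_of_pos hlam, EReal.coe_sub_bot]
    simp
  | top =>
    rw [EReal.coe_mul_top_of_pos hlam, EReal.sub_top]
    simp
  | coe g =>
    norm_cast
    rw [div_le_iff₀ hlam]
    constructor <;> intro h <;> linarith

/-- Convexity of the single minimization problem. -/
theorem eConvexOn_singleObjective (c : Fin n → Fin T → ℝ) (p : Fin n → ℝ)
    (A : Matrix (Fin m) (Fin T ⊕ Fin n) ℝ) (b : Fin m → ℝ) {φ : (Fin n → ℝ) → ℝ}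
    {H : Set (Fin n → ℝ)} {lam B : ℝ} (hφ : ConvexOn ℝ Set.univ φ) (hH : Convex ℝ H)
    (hlam : 0 < lam) (hHB : ∀ h ∈ H, 0 ≤ h ∧ p ⬝ᵥ h = B) :
    EConvexOn (singleFeasible A H) (singleObjective c p b φ lam) := by
  have hconv : Convex ℝ (singleFeasible A H) := by
    rintro ⟨h, μ, ν⟩ ⟨h₁, h₂, h₃⟩ ⟨h', μ', ν'⟩ ⟨h₁', h₂', h₃'⟩ α β hα hβ hαβ
    exact ⟨hH h₁ h₁' hα hβ hαβ, add_nonneg (smul_nonneg hα h₂) (smul_nonneg hβ h₂'),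
      convex_dualConstraints A (x := (μ, ν)) h₃ (y := (μ', ν')) h₃' hα hβ hαβ⟩
  refine ⟨hconv, ?_⟩
  rintro ⟨⟨h, μ, ν⟩, r⟩ ⟨hs, hr⟩ ⟨⟨h', μ', ν'⟩, r'⟩ ⟨hs', hr'⟩ α β hα hβ hαβ
  have hs'' := hconv hs hs' hα hβ hαβ
  refine ⟨hs'', ?_⟩
  simp only [Prod.smul_mk, Prod.mk_add_mk] at hr hr' hs'' ⊢
  rw [singleObjective_eq hlam hs.2.2, coe_sub_mul_le_iff hlam] at hr
  rw [singleObjective_eq hlam hs'.2.2, coe_sub_mul_le_iff hlam] at hr'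
  rw [singleObjective_eq hlam hs''.2.2, coe_sub_mul_le_iff hlam]
  have key := ((eConcaveOn_dualFun c p A b B).2 (x := ((h, μ, ν), (φ h - r) / lam))
    ⟨hHB h hs.1, hr⟩ (y := ((h', μ', ν'), (φ h' - r') / lam)) ⟨hHB h' hs'.1, hr'⟩ hα hβ hαβ).2
  refine le_trans ?_ key
  simp only [Prod.smul_mk, Prod.mk_add_mk, smul_eq_mul, EReal.coe_le_coe_iff]
  have hφ' := hφ.2 (Set.mem_univ h) (Set.mem_univ h') hα hβ hαβ
  simp only [smul_eq_mul] at hφ'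
  have e : α * ((φ h - r) / lam) + β * ((φ h' - r') / lam) =
      (α * (φ h - r) + β * (φ h' - r')) / lam := by ring
  rw [e]
  gcongr
  linarith

/-! ### Duality -/

theorem spreadMatrix_mulVec (y : Fin T → ℝ) (s : Fin n → ℝ) (i : Fin n) (t : Fin T) :
    (spreadMatrix n T *ᵥ Sum.elim y s) (i, t) = y t + s i := by
  simp [spreadMatrix, Matrix.mulVec, dotProduct]

theorem DualConstraints.sum_mul_add {A : Matrix (Fin m) (Fin T ⊕ Fin n) ℝ} {μ : Fin m → ℝ}
    {ν : Fin n × Fin T → ℝ} (hc : DualConstraints A μ ν) (y : Fin T → ℝ) (s : Fin n → ℝ) :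
    ∑ i, ∑ t, ν (i, t) * (y t + s i) = μ ⬝ᵥ (A *ᵥ Sum.elim y s) := by
  rw [Matrix.dotProduct_mulVec, ← Matrix.mulVec_transpose, sub_eq_zero.1 hc.1,
    Matrix.mulVec_transpose, ← Matrix.dotProduct_mulVec, dotProduct, Fintype.sum_prod_type]
  simp only [spreadMatrix_mulVec]

/-- Positivity only needs one positive product `h i * c i t`, which does not depend on the yields or
spreads. -/
theorem portfolioValue_pos {c : Fin n → Fin T → ℝ} (hc : ∀ i t, 0 ≤ c i t) {h : Fin n → ℝ}
    (hh : 0 ≤ h) {y₀ : Fin T → ℝ} {s₀ : Fin n → ℝ} (h₀ : 0 < portfolioValue c h y₀ s₀)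
    (y : Fin T → ℝ) (s : Fin n → ℝ) : 0 < portfolioValue c h y s := by
  unfold portfolioValue at h₀ ⊢
  rw [← Fintype.sum_prod_type'] at h₀ ⊢
  obtain ⟨q, -, hq⟩ := Finset.exists_lt_of_sum_lt (s := Finset.univ) (f := fun _ => (0 : ℝ))
    (by simpa using h₀)
  have := pos_of_mul_pos_left hq (Real.exp_pos _).le
  exact Finset.sum_pos' (fun q _ => mul_nonneg (mul_nonneg (hh _) (hc _ _)) (Real.exp_pos _).le)
    ⟨q, Finset.mem_univ _, mul_pos this (Real.exp_pos _)⟩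

theorem bondPrice_dotProduct (c : Fin n → Fin T → ℝ) (y : Fin T → ℝ) (s : Fin n → ℝ)
    (h : Fin n → ℝ) : bondPrice c y s ⬝ᵥ h = portfolioValue c h y s := by
  simp only [dotProduct, bondPrice, portfolioValue, Finset.sum_mul]
  exact Finset.sum_congr rfl fun i _ => Finset.sum_congr rfl fun t _ => by ring

/-- Weak duality. -/
theorem neg_sub_entropySum_le {c : Fin n → Fin T → ℝ}
    {A : Matrix (Fin m) (Fin T ⊕ Fin n) ℝ} {b : Fin m → ℝ} {h : Fin n → ℝ} {μ : Fin m → ℝ}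
    {ν : Fin n × Fin T → ℝ} (hμ : 0 ≤ μ) (hc : DualConstraints A μ ν)
    (hd : EntropiesFinite c h ν) {y : Fin T → ℝ} {s : Fin n → ℝ}
    (hys : A *ᵥ Sum.elim y s ≤ b) (hV : 0 < portfolioValue c h y s) :
    -(μ ⬝ᵥ b) - entropySum c h ν ≤ Real.log (portfolioValue c h y s) := by
  set V := portfolioValue c h y s with hVdef
  have hterm : ∀ i t, -(ν (i, t) * (y t + s i)) + (1 - Real.log V) * (ν (i, t) / period t)
      - h i * c i t * Real.exp (-(period t) * (y t + s i)) / V ≤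
      ν (i, t) / period t * Real.log (ν (i, t) / period t / (c i t * h i)) := by
    intro i t
    -- With the shift by `log V`, the exponential terms sum to `V / V = 1` and cancel the sum of the
    -- `ν (i, t) / period t`.
    have := (hd i t).le_mul_log (-(period t) * (y t + s i) - Real.log V)
    rw [Real.exp_sub, Real.exp_log hV] at this
    refine le_trans (le_of_eq ?_) this
    have := (period_pos t).ne'
    field_simp
    ring
  have hsum := Finset.sum_le_sum fun i (_ : i ∈ Finset.univ) =>
    Finset.sum_le_sum fun t (_ : t ∈ Finset.univ) => hterm i t
  simp only [Finset.sum_sub_distrib, Finset.sum_add_distrib, Finset.sum_neg_distrib,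
    ← Finset.mul_sum, ← Finset.sum_div, hc.sum_mul_add y s, hc.2.1] at hsum
  have h1 : (∑ i, ∑ t, h i * c i t * Real.exp (-(period t) * (y t + s i))) / V = 1 :=
    div_self hV.ne'
  rw [h1] at hsum
  have h2 : μ ⬝ᵥ (A *ᵥ Sum.elim y s) ≤ μ ⬝ᵥ b := dotProduct_le_dotProduct_of_nonneg_left hys hμ
  unfold entropySum
  linarith

/-- Strong duality: a minimizer of the portfolio value yields dual variables without gap. -/
theorem exists_dual_eq {c : Fin n → Fin T → ℝ} (hc : ∀ i t, 0 ≤ c i t)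
    {A : Matrix (Fin m) (Fin T ⊕ Fin n) ℝ} {b : Fin m → ℝ} {h : Fin n → ℝ} (hh : 0 ≤ h)
    {y : Fin T → ℝ} {s : Fin n → ℝ} (hys : (y, s) ∈ uncertaintySet A b)
    (hmin : ∀ x ∈ uncertaintySet A b, portfolioValue c h y s ≤ portfolioValue c h x.1 x.2)
    (hV : 0 < portfolioValue c h y s) :
    ∃ (μ : Fin m → ℝ) (ν : Fin n × Fin T → ℝ), 0 ≤ μ ∧ DualConstraints A μ ν ∧
      EntropiesFinite c h ν ∧
      -(μ ⬝ᵥ b) - entropySum c h ν = Real.log (portfolioValue c h y s) := by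
  set V := portfolioValue c h y s with hVdef
  let F := spreadMatrix n T
  let f : (Fin T ⊕ Fin n → ℝ) → ℝ := fun x =>
    ∑ q : Fin n × Fin T, h q.1 * c q.1 q.2 * Real.exp (-(period q.2) * (F *ᵥ x) q)
  -- Share of the portfolio value due to each cash flow. The gradient of the value is then `-V Fᵀ
  -- ν`, which explains the later scaling of `μ` by `V⁻¹`.
  let w : Fin n × Fin T → ℝ := fun q =>
    h q.1 * c q.1 q.2 * Real.exp (-(period q.2) * (y q.2 + s q.1)) / V
  let ν : Fin n × Fin T → ℝ := fun q => period q.2 * w q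
  have hF : ∀ q, (F *ᵥ Sum.elim y s) q = y q.2 + s q.1 := fun q => spreadMatrix_mulVec y s _ _
  have hf : ∀ x, f x = portfolioValue c h (x ∘ Sum.inl) (x ∘ Sum.inr) := by
    intro x
    simp only [f, portfolioValue, Fintype.sum_prod_type]
    refine Finset.sum_congr rfl fun i _ => Finset.sum_congr rfl fun t _ => ?_
    rw [← spreadMatrix_mulVec, Sum.elim_comp_inl_inr]
  obtain ⟨μ, hμ, hstat, hcomp⟩ := exists_multipliers_of_isMinOn A b f (Sum.elim y s)
    (-(V • (Fᵀ *ᵥ ν))) hys (fun z hz => by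
      rw [hf, hf]
      exact hmin (z ∘ Sum.inl, z ∘ Sum.inr) (by
        change A *ᵥ Sum.elim (z ∘ Sum.inl) (z ∘ Sum.inr) ≤ b
        rwa [Sum.elim_comp_inl_inr])) (fun d => by
      have hder : ∀ q : Fin n × Fin T, HasDerivAt
          (fun ε : ℝ => h q.1 * c q.1 q.2 *
            Real.exp (-(period q.2) * (F *ᵥ (Sum.elim y s + ε • d)) q))
          (-(V * (ν q * (F *ᵥ d) q))) 0 := by
        intro q
        simp only [Matrix.mulVec_add, Matrix.mulVec_smul, Pi.add_apply, Pi.smul_apply, hF,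
          smul_eq_mul]
        have h1 : HasDerivAt (fun ε : ℝ => -(period q.2) * (y q.2 + s q.1 + ε * (F *ᵥ d) q))
            (-(period q.2) * (1 * (F *ᵥ d) q)) 0 :=
          (((hasDerivAt_id (0 : ℝ)).mul_const _).const_add _).const_mul _
        refine (h1.exp.const_mul (h q.1 * c q.1 q.2)).congr_deriv ?_
        simp only [ν, w, zero_mul, add_zero]
        field_simp
      refine (HasDerivAt.fun_sum fun q (_ : q ∈ Finset.univ) => hder q).congr_deriv ?_
      rw [neg_dotProduct, smul_dotProduct, Matrix.mulVec_transpose, ← Matrix.dotProduct_mulVec,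
        dotProduct, Finset.sum_neg_distrib, ← Finset.mul_sum, smul_eq_mul])
  have hw : ∀ i t, ν (i, t) / period t = w (i, t) := fun i t => by
    simp only [ν]
    rw [mul_div_cancel_left₀ _ (period_pos t).ne']
  have hw₀ : ∀ q, 0 ≤ w q := fun q =>
    div_nonneg (mul_nonneg (mul_nonneg (hh _) (hc _ _)) (Real.exp_pos _).le) hV.le
  have hcon : DualConstraints A (V⁻¹ • μ) ν := by
    refine ⟨?_, ?_, fun q => mul_nonneg (period_pos _).le (hw₀ q)⟩
    · rw [← sub_eq_add_neg, sub_eq_zero] at hstat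
      rw [Matrix.mulVec_smul, hstat, smul_smul, inv_mul_cancel₀ hV.ne', one_smul, sub_self]
    · simp only [hw, w, ← Finset.sum_div]
      exact div_self hV.ne'
  refine ⟨V⁻¹ • μ, ν, smul_nonneg (inv_nonneg.2 hV.le) hμ, hcon, ?_, ?_⟩
  · intro i t
    rw [hw]
    refine ⟨mul_nonneg (hc _ _) (hh _), hw₀ _, fun hpos => ?_⟩
    have h1 : 0 < h i * c i t * Real.exp (-(period t) * (y t + s i)) :=
      (div_pos_iff_of_pos_right hV).1 hpos
    rw [mul_comm]
    exact pos_of_mul_pos_left h1 (Real.exp_pos _).le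
  · have hterm : ∀ i t,
        ν (i, t) / period t * Real.log (ν (i, t) / period t / (c i t * h i)) =
          -(ν (i, t) * (y t + s i)) - Real.log V * (ν (i, t) / period t) := by
      intro i t
      have hνw : ν (i, t) = period t * w (i, t) := rfl
      rw [hw, hνw]
      -- A zero cash flow has zero share, so both sides vanish; otherwise the ratio is the discount
      -- factor over `V` and its logarithm is explicit.
      by_cases hz : h i * c i t = 0
      · simp [w, hz]
      · have h1 : w (i, t) / (c i t * h i) = Real.exp (-(period t) * (y t + s i)) / V := by
          simp only [w]
          rw [mul_comm (c i t) (h i), mul_div_assoc, mul_div_cancel_left₀ _ hz]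
        rw [h1, Real.log_div (Real.exp_pos _).ne' hV.ne', Real.log_exp]
        ring
    have hsum : entropySum c h ν = -(V⁻¹ • μ ⬝ᵥ b) - Real.log V := by
      simp only [entropySum, hterm, Finset.sum_sub_distrib, Finset.sum_neg_distrib,
        ← Finset.mul_sum, hcon.sum_mul_add y s, hcon.2.1, smul_dotProduct, hcomp, mul_one]
    rw [hsum]
    ring

/-- The worst case change in log value is attained and equals the maximum of the dual function. -/
theorem worstCaseLogChange_duality {c : Fin n → Fin T → ℝ} (hc : ∀ i t, 0 ≤ c i t)
    (ynom : Fin T → ℝ) (snom : Fin n → ℝ)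
    {A : Matrix (Fin m) (Fin T ⊕ Fin n) ℝ} {b : Fin m → ℝ}
    (hU_ne : (uncertaintySet A b).Nonempty) (hU_compact : IsCompact (uncertaintySet A b))
    {h : Fin n → ℝ} (hh : 0 ≤ h) (hpos : 0 < bondPrice c ynom snom ⬝ᵥ h) :
    IsLeast ((fun x => (logChange c ynom snom h x.1 x.2 : EReal)) '' uncertaintySet A b)
      (worstCaseLogChange c ynom snom (uncertaintySet A b) h) ∧
    IsGreatest {v : EReal | ∃ (μ : Fin m → ℝ) (ν : Fin n × Fin T → ℝ),
        0 ≤ μ ∧ v = dualFun c (bondPrice c ynom snom) A b h μ ν}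
      (worstCaseLogChange c ynom snom (uncertaintySet A b) h) := by
  have hV := portfolioValue_pos hc hh (by rwa [bondPrice_dotProduct] at hpos)
  have hcont : Continuous fun x : (Fin T → ℝ) × (Fin n → ℝ) => portfolioValue c h x.1 x.2 := by
    unfold portfolioValue
    fun_prop
  obtain ⟨⟨y, s⟩, hys, hmin⟩ := hU_compact.exists_isMinOn hU_ne hcont.continuousOn
  have hlog : ∀ x ∈ uncertaintySet A b,
      (logChange c ynom snom h y s : EReal) ≤ (logChange c ynom snom h x.1 x.2 : EReal) := by
    intro x hx
    rw [EReal.coe_le_coe_iff]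
    exact sub_le_sub_right (Real.log_le_log (hV y s) (hmin hx)) _
  have hwc : worstCaseLogChange c ynom snom (uncertaintySet A b) h =
      (logChange c ynom snom h y s : EReal) :=
    le_antisymm (iInf₂_le (y, s) hys) (le_iInf₂ hlog)
  rw [hwc]
  refine ⟨⟨⟨(y, s), hys, rfl⟩, ?_⟩, ?_, ?_⟩
  · rintro _ ⟨x, hx, rfl⟩
    exact hlog x hx
  · obtain ⟨μ, ν, hμ, hcon, hd, heq⟩ := exists_dual_eq hc hh hys (fun x hx => hmin hx) (hV y s)
    refine ⟨μ, ν, hμ, ?_⟩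
    rw [dualFun_of_finite hcon hd, bondPrice_dotProduct, logChange, ← heq]
    congr 1
    ring
  · rintro _ ⟨μ, ν, hμ, rfl⟩
    by_cases hcd : DualConstraints A μ ν ∧ EntropiesFinite c h ν
    · rw [dualFun_of_finite hcd.1 hcd.2, bondPrice_dotProduct, logChange, EReal.coe_le_coe_iff]
      have := neg_sub_entropySum_le hμ hcd.1 hcd.2 hys (hV y s)
      linarith
    · rw [dualFun_of_not_finite hcd]
      exact bot_le

/-! ### Elimination of the dual variables -/

/-- Minimizing `f` is equivalent to minimizing jointly a function whose partial minimum is attained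
and equals `f`. -/
theorem iInf_eq_and_isMinOn_iff_of_partial_min {X Y : Type*} {H : Set X} {S : Set (X × Y)}
    {f : X → EReal} {F : X × Y → EReal} (hS : ∀ q ∈ S, q.1 ∈ H) (hle : ∀ q ∈ S, f q.1 ≤ F q)
    (hex : ∀ x ∈ H, ∃ y, (x, y) ∈ S ∧ F (x, y) = f x) :
    (⨅ x ∈ H, f x) = (⨅ q ∈ S, F q) ∧
      ∀ x, (x ∈ H ∧ IsMinOn f H x) ↔ ∃ y, (x, y) ∈ S ∧ IsMinOn F S (x, y) := by
  refine ⟨le_antisymm ?_ ?_, fun x => ⟨?_, ?_⟩⟩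
  · exact le_iInf₂ fun q hq => (iInf₂_le q.1 (hS q hq)).trans (hle q hq)
  · refine le_iInf₂ fun x hx => ?_
    obtain ⟨y, hy, hxy⟩ := hex x hx
    exact hxy ▸ iInf₂_le (x, y) hy
  · rintro ⟨hx, hmin⟩
    obtain ⟨y, hy, hxy⟩ := hex x hx
    exact ⟨y, hy, fun q hq => (hxy.le.trans (hmin (hS q hq))).trans (hle q hq)⟩
  · rintro ⟨y, hy, hmin⟩
    refine ⟨hS _ hy, fun x' hx' => ?_⟩
    obtain ⟨y', hy', hxy'⟩ := hex x' hx'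
    exact ((hle _ hy).trans (hmin hy')).trans hxy'.le

end BondPortfolio

theorem mainTheorem2 {n T m : ℕ}
    (c : Fin n → Fin T → ℝ) (hc : ∀ i t, 0 ≤ c i t)
    (ynom : Fin T → ℝ) (snom : Fin n → ℝ)
    (p : Fin n → ℝ) (hp : p = BondPortfolio.bondPrice c ynom snom)
    (A : Matrix (Fin m) (Fin T ⊕ Fin n) ℝ) (b : Fin m → ℝ)
    (U : Set ((Fin T → ℝ) × (Fin n → ℝ))) (hU : U = BondPortfolio.uncertaintySet A b)
    (hU_ne : U.Nonempty) (hU_compact : IsCompact U) :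
    -- the worst case is attained, and equals the maximum of the dual function
    (∀ h : Fin n → ℝ, 0 ≤ h → 0 < p ⬝ᵥ h →
      IsLeast ((fun x => (BondPortfolio.logChange c ynom snom h x.1 x.2 : EReal)) '' U)
        (BondPortfolio.worstCaseLogChange c ynom snom U h) ∧
      IsGreatest {v : EReal | ∃ (μ : Fin m → ℝ) (ν : Fin n × Fin T → ℝ),
          0 ≤ μ ∧ v = BondPortfolio.dualFun c p A b h μ ν}
        (BondPortfolio.worstCaseLogChange c ynom snom U h)) ∧
    -- the dual function is jointly concave over the long-only portfolios with a given budget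
    (∀ B : ℝ, 0 < B →
      BondPortfolio.EConcaveOn
        {q : (Fin n → ℝ) × (Fin m → ℝ) × (Fin n × Fin T → ℝ) | 0 ≤ q.1 ∧ p ⬝ᵥ q.1 = B}
        (fun q => BondPortfolio.dualFun c p A b q.1 q.2.1 q.2.2)) ∧
    -- the robust construction problem is equivalent to a single convex minimization
    (∀ (φ : (Fin n → ℝ) → ℝ) (H : Set (Fin n → ℝ)) (lam B : ℝ),
      ConvexOn ℝ Set.univ φ → Convex ℝ H → 0 < lam → 0 < B →
      (∀ h ∈ H, 0 ≤ h ∧ p ⬝ᵥ h = B) →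
      BondPortfolio.EConvexOn (BondPortfolio.singleFeasible A H)
        (BondPortfolio.singleObjective c p b φ lam) ∧
      (⨅ h ∈ H, BondPortfolio.robustObjective c ynom snom U φ lam h) =
        (⨅ q ∈ BondPortfolio.singleFeasible A H, BondPortfolio.singleObjective c p b φ lam q) ∧
      ∀ h : Fin n → ℝ,
        (h ∈ H ∧ IsMinOn (BondPortfolio.robustObjective c ynom snom U φ lam) H h) ↔
        ∃ (μ : Fin m → ℝ) (ν : Fin n × Fin T → ℝ),
          (h, μ, ν) ∈ BondPortfolio.singleFeasible A H ∧
          IsMinOn (BondPortfolio.singleObjective c p b φ lam)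
            (BondPortfolio.singleFeasible A H) (h, μ, ν)) := by
  subst hp hU
  refine ⟨fun h hh hpos => BondPortfolio.worstCaseLogChange_duality hc ynom snom hU_ne hU_compact
    hh hpos, fun B _ => BondPortfolio.eConcaveOn_dualFun c _ A b B, ?_⟩
  intro φ H lam B hφ hH hlam hB hHB
  refine ⟨BondPortfolio.eConvexOn_singleObjective c _ A b hφ hH hlam hHB, ?_⟩
  have hdual := fun h (hh : h ∈ H) => (BondPortfolio.worstCaseLogChange_duality hc ynom snom hU_ne
    hU_compact (hHB h hh).1 ((hHB h hh).2.symm ▸ hB)).2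
  have key := BondPortfolio.iInf_eq_and_isMinOn_iff_of_partial_min (H := H)
    (S := BondPortfolio.singleFeasible A H)
    (f := BondPortfolio.robustObjective c ynom snom (BondPortfolio.uncertaintySet A b) φ lam)
    (F := BondPortfolio.singleObjective c (BondPortfolio.bondPrice c ynom snom) b φ lam)
    (fun q hq => hq.1) (by
      rintro ⟨h, μ, ν⟩ ⟨hh, hμ, hcon⟩
      rw [BondPortfolio.singleObjective_eq hlam hcon]
      have := (hdual h hh).2 ⟨μ, ν, hμ, rfl⟩
      exact EReal.sub_le_sub le_rfl (mul_le_mul_of_nonneg_left this (by exact_mod_cast hlam.le)))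
    (by
      intro h hh
      obtain ⟨⟨μ, ν, hμ, heq⟩, -⟩ := hdual h hh
      -- The worst case is attained, hence a real number, so the maximal dual value is not `⊥` and
      -- the maximizer is feasible.
      have hcon : BondPortfolio.DualConstraints A μ ν := by
        obtain ⟨⟨x, -, hx⟩, -⟩ := (BondPortfolio.worstCaseLogChange_duality hc ynom snom hU_ne
          hU_compact (hHB h hh).1 ((hHB h hh).2.symm ▸ hB)).1
        exact (BondPortfolio.coe_le_dualFun_iff.1 (hx.trans heq).le).1
      refine ⟨(μ, ν), ⟨hh, hμ, hcon⟩, ?_⟩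
      rw [BondPortfolio.singleObjective_eq hlam hcon, BondPortfolio.robustObjective, heq])
  simpa only [Prod.exists] using key
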